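/- Let $k$ be a field, let $n\ge 1$ be an integer, let $\{x_{ij}^{(\nu)} : 1\le i,j\le n,\ \nu\in I\}$ be independent commuting indeterminates over $k$ ($I$ any index set, for instance $\{1,\dots,s\}$ or $\mathbb N$), and put $R=k[x_{ij}^{(\nu)}]$, $K=\operatorname{Frac}(R)=k(x_{ij}^{(\nu)})$, with algebraic closure $\overline K$. Let $k\{X\}$ be the algebra of generic $n\times n$ matrices, that is, the $k$-subalgebra of $M_n(R)$ generated by the generic matrices $X_\nu=(x_{ij}^{(\nu)})$, $\nu\in I$. Let $A\in k\{X\}$, regarded as a matrix over $K$. Then: (a) The minimal polynomial of $A$ over $K$ is irreducible over $K$. If moreover the characteristic of $k$ does not divide $n$ (in particular if $\operatorname{char} k=0$), then $A$ is diagonalizable over $\overline K$. (b) The eigenvalues of $A$ in $\overline K$ are exactly the roots in $\overline K$ of its (irreducible) minimal polynomial, and all of them have the same multiplicity as roots of the characteristic polynomial of $A$. (c) The characteristic polynomial of $A$ is a power, with positive exponent, of the minimal polynomial of $A$. -/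

import Mathlib

namespace GenericMatrices

/-- The commutative polynomial ring `k[x_ij^(ν)]` in the independent entries of the generic
`n × n` matrices indexed by `ι`. -/
abbrev EntryRing (k : Type*) [Field k] (ι : Type*) (n : ℕ) : Type _ :=
  MvPolynomial (ι × Fin n × Fin n) k

/-- The fraction field `k(x_ij^(ν))` of the ring of entries. -/
abbrev EntryField (k : Type*) [Field k] (ι : Type*) (n : ℕ) : Type _ :=
  FractionRing (EntryRing k ι n)

/-- The generic matrix `X_ν = (x_ij^(ν))`. -/
noncomputable def genericMatrix (k : Type*) [Field k] {ι : Type*} (n : ℕ) (ν : ι) :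
    Matrix (Fin n) (Fin n) (EntryRing k ι n) :=
  Matrix.of fun i j => MvPolynomial.X (ν, i, j)

/-- The algebra of generic matrices: the `k`-subalgebra of `M_n(k[x_ij^(ν)])` generated by all
the generic matrices `X_ν`. -/
noncomputable def genericAlgebra (k : Type*) [Field k] (ι : Type*) (n : ℕ) :
    Subalgebra k (Matrix (Fin n) (Fin n) (EntryRing k ι n)) :=
  Algebra.adjoin k (Set.range fun ν : ι => genericMatrix k n ν)

/-- A matrix over the ring of entries, seen over the field `k(x_ij^(ν))`. -/
noncomputable def overField {k : Type*} [Field k] {ι : Type*} {n : ℕ}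
    (A : Matrix (Fin n) (Fin n) (EntryRing k ι n)) :
    Matrix (Fin n) (Fin n) (EntryField k ι n) :=
  A.map (algebraMap (EntryRing k ι n) (EntryField k ι n))

/-- A square matrix over a field `F`, seen over the algebraic closure of `F`. -/
noncomputable def overClosure {F : Type*} [Field F] {n : ℕ} (A : Matrix (Fin n) (Fin n) F) :
    Matrix (Fin n) (Fin n) (AlgebraicClosure F) :=
  A.map (algebraMap F (AlgebraicClosure F))

/-- A square matrix over a field `L` is diagonalizable (over `L`) if it is conjugate to a
diagonal matrix by an invertible matrix over `L`. -/
def IsDiagonalizable {L : Type*} [Field L] {n : ℕ} (A : Matrix (Fin n) (Fin n) L) : Prop :=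
  ∃ (P : (Matrix (Fin n) (Fin n) L)ˣ) (d : Fin n → L),
    A = (P : Matrix (Fin n) (Fin n) L) * Matrix.diagonal d *
      ((P⁻¹ : (Matrix (Fin n) (Fin n) L)ˣ) : Matrix (Fin n) (Fin n) L)

/-- The scalar `a` is an eigenvalue of the square matrix `A`. -/
def IsEigenvalue {L : Type*} [Field L] {n : ℕ} (A : Matrix (Fin n) (Fin n) L) (a : L) : Prop :=
  Module.End.HasEigenvalue (Matrix.toLin' A) a

end GenericMatrices

namespace GenericMatrices

open Polynomial

/-! ### Consequences of an irreducible minimal polynomial -/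

section LinearAlgebra

variable {K : Type*} [Field K] {n : ℕ}

/-! Everything follows by linear algebra from irreducibility of the minimal polynomial
(`irreducible_minpoly`). By Gauss's lemma, a monic factorization of it lifts to polynomials `p`, `q`
over the entry ring dividing the characteristic polynomial, with `p(A) q(A) = 0`; one of the two
values has to vanish.

The coefficients of `p` and `q` are invariant under simultaneous conjugation (`coeff_invariant`):
along a path of invertible matrices the characteristic polynomial is constant, so the coefficients
of its monic factors are integral over the base field, hence constant. Now weight the entry `x_jl`
by `y ^ ((l - j) mod n)`. This injects the generic algebra into a matrix model of a skew polynomial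
ring, where leading terms show that there are no zero divisors. Invariance under diagonal and cyclic
permutation matrices makes the coefficients central there, so `p(A)` and `q(A)` land in the same
ring. -/

theorem isEigenvalue_iff_isRoot_charpoly (A : Matrix (Fin n) (Fin n) K) (a : K) :
    IsEigenvalue A a ↔ A.charpoly.IsRoot a := by
  rw [IsEigenvalue, Module.End.hasEigenvalue_iff_mem_spectrum, Matrix.spectrum_toLin',
    Matrix.mem_spectrum_iff_isRoot_charpoly]

theorem isEigenvalue_iff_isRoot_minpoly (A : Matrix (Fin n) (Fin n) K) (a : K) :
    IsEigenvalue A a ↔ (minpoly K A).IsRoot a := by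
  rw [IsEigenvalue, Module.End.hasEigenvalue_iff_isRoot, Matrix.minpoly_toLin']

theorem charpoly_overClosure (A : Matrix (Fin n) (Fin n) K) :
    (overClosure A).charpoly = A.charpoly.map (algebraMap K (AlgebraicClosure K)) :=
  Matrix.charpoly_map _ _

theorem aeval_map_matrix {R S : Type*} [CommRing R] [CommRing S] (φ : R →+* S)
    (A : Matrix (Fin n) (Fin n) R) (p : R[X]) :
    (aeval A p).map φ = aeval (A.map φ) (p.map φ) := by
  change φ.mapMatrix (aeval A p) = aeval (φ.mapMatrix A) (p.map φ)
  rw [aeval_def, hom_eval₂, aeval_def, eval₂_map]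
  congr 1
  ext x i j
  by_cases h : i = j <;> simp [Matrix.algebraMap_matrix_apply, h]

theorem aeval_map_minpoly_eq_zero {L : Type*} [Field L] [Algebra K L]
    (A : Matrix (Fin n) (Fin n) K) :
    aeval (A.map (algebraMap K L)) ((minpoly K A).map (algebraMap K L)) = 0 := by
  rw [← aeval_map_matrix, minpoly.aeval]
  simp

theorem minpoly_overClosure_dvd (A : Matrix (Fin n) (Fin n) K) :
    minpoly (AlgebraicClosure K) (overClosure A) ∣
      (minpoly K A).map (algebraMap K (AlgebraicClosure K)) :=
  minpoly.dvd _ _ (aeval_map_minpoly_eq_zero A)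

/-- Any irreducible factor of the characteristic polynomial has a root in the closure; this is an
eigenvalue, hence a root of the minimal polynomial, so the two irreducibles agree. -/
theorem charpoly_eq_minpoly_pow_of_irreducible (hn : 0 < n) (A : Matrix (Fin n) (Fin n) K)
    (hirr : Irreducible (minpoly K A)) :
    ∃ r : ℕ, 0 < r ∧ A.charpoly = minpoly K A ^ r := by
  classical
  have hmon : (minpoly K A).Monic := minpoly.monic (Matrix.isIntegral A)
  have hfac : ∀ q ∈ UniqueFactorizationMonoid.normalizedFactors A.charpoly, q = minpoly K A := by
    intro q hq
    have hqi := UniqueFactorizationMonoid.irreducible_of_normalized_factor q hq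
    have hqd := UniqueFactorizationMonoid.dvd_of_mem_normalizedFactors hq
    have hqn := UniqueFactorizationMonoid.normalize_normalized_factor q hq
    obtain ⟨a, ha⟩ := IsAlgClosed.exists_aeval_eq_zero (AlgebraicClosure K) q
      (degree_pos_of_irreducible hqi).ne'
    have hroot : IsEigenvalue (overClosure A) a := by
      rw [isEigenvalue_iff_isRoot_charpoly, charpoly_overClosure, IsRoot.def, eval_map_algebraMap]
      obtain ⟨s, hs⟩ := hqd
      rw [hs, map_mul, ha, zero_mul]
    rw [isEigenvalue_iff_isRoot_minpoly] at hroot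
    have ham := hroot.dvd (minpoly_overClosure_dvd A)
    rw [IsRoot.def, eval_map_algebraMap] at ham
    have h1 := minpoly.eq_of_irreducible_of_monic hirr ham hmon
    have hqm : q.Monic := hqn ▸ monic_normalize hqi.ne_zero
    rw [h1, minpoly.eq_of_irreducible_of_monic hqi ha hqm]
  have hprod := UniqueFactorizationMonoid.prod_normalizedFactors_eq (Matrix.charpoly_monic A).ne_zero
  rw [Multiset.eq_replicate_of_mem hfac, Multiset.prod_replicate,
    (Matrix.charpoly_monic A).normalize_eq_self] at hprod
  refine ⟨_, Nat.pos_of_ne_zero fun h0 => ?_, hprod.symm⟩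
  rw [h0, pow_zero] at hprod
  have := Matrix.charpoly_natDegree_eq_dim A
  rw [← hprod] at this
  simp at this
  omega

theorem isEigenvalue_overClosure_iff (hn : 0 < n) (A : Matrix (Fin n) (Fin n) K)
    (hirr : Irreducible (minpoly K A)) (a : AlgebraicClosure K) :
    IsEigenvalue (overClosure A) a ↔ aeval a (minpoly K A) = 0 := by
  obtain ⟨r, hr, h⟩ := charpoly_eq_minpoly_pow_of_irreducible hn A hirr
  rw [isEigenvalue_iff_isRoot_charpoly, charpoly_overClosure, IsRoot.def, eval_map_algebraMap, h,
    map_pow, pow_eq_zero_iff hr.ne']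

/-- A `K`-automorphism of `L` carries one root to the other and fixes `p`. No separability is
needed. -/
theorem rootMultiplicity_map_eq_of_isConjRoot {L : Type*} [Field L] [Algebra K L] [Normal K L]
    (p : K[X]) {a b : L} (h : IsConjRoot K a b) :
    rootMultiplicity a (p.map (algebraMap K L)) = rootMultiplicity b (p.map (algebraMap K L)) := by
  obtain ⟨e, rfl⟩ := h.exists_algEquiv
  rw [eq_rootMultiplicity_map (f := (e : L →+* L)) e.injective b, Polynomial.map_map]
  congr 2
  exact e.toAlgHom.comp_algebraMap.symm

theorem exists_rootMultiplicity_eq (hn : 0 < n) (A : Matrix (Fin n) (Fin n) K)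
    (hirr : Irreducible (minpoly K A)) :
    ∃ r : ℕ, 0 < r ∧ ∀ a : AlgebraicClosure K, IsEigenvalue (overClosure A) a →
      rootMultiplicity a (overClosure A).charpoly = r := by
  have hmon : (minpoly K A).Monic := minpoly.monic (Matrix.isIntegral A)
  obtain ⟨b, hb⟩ := IsAlgClosed.exists_aeval_eq_zero (AlgebraicClosure K) (minpoly K A)
      (degree_pos_of_irreducible hirr).ne'
  refine ⟨rootMultiplicity b (overClosure A).charpoly, ?_, fun a ha => ?_⟩
  · rw [rootMultiplicity_pos (Matrix.charpoly_monic _).ne_zero, ← isEigenvalue_iff_isRoot_charpoly]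
    exact (isEigenvalue_overClosure_iff hn A hirr b).2 hb
  · rw [isEigenvalue_overClosure_iff hn A hirr] at ha
    rw [charpoly_overClosure]
    apply rootMultiplicity_map_eq_of_isConjRoot
    rw [isConjRoot_def, ← minpoly.eq_of_irreducible_of_monic hirr ha hmon,
      ← minpoly.eq_of_irreducible_of_monic hirr hb hmon]

/-- A vanishing derivative kills the degree of the minimal polynomial in `K`; that degree divides
`n`. -/
theorem separable_minpoly_of_irreducible (hn : 0 < n) (A : Matrix (Fin n) (Fin n) K)
    (hirr : Irreducible (minpoly K A)) (hnK : (n : K) ≠ 0) : (minpoly K A).Separable := by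
  have hmon : (minpoly K A).Monic := minpoly.monic (Matrix.isIntegral A)
  obtain ⟨r, hr, h⟩ := charpoly_eq_minpoly_pow_of_irreducible hn A hirr
  rw [separable_iff_derivative_ne_zero hirr]
  intro hd
  have hdeg : n = r * (minpoly K A).natDegree := by
    simpa [hmon.natDegree_pow, h] using (Matrix.charpoly_natDegree_eq_dim A).symm
  have hpos : 0 < (minpoly K A).natDegree := natDegree_pos_iff_degree_pos.2
    (degree_pos_of_irreducible hirr)
  have hc := congrArg (fun p => coeff p ((minpoly K A).natDegree - 1)) hd
  simp only [coeff_derivative, Nat.sub_add_cancel hpos, coeff_zero, hmon.coeff_natDegree,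
    one_mul] at hc
  apply hnK
  rw [hdeg, Nat.cast_mul, show ((minpoly K A).natDegree : K) = 0 by
    rw [← hc, ← Nat.cast_add_one, Nat.sub_add_cancel hpos], mul_zero]

theorem isDiagonalizable_of_iSup_eigenspace_eq_top (A : Matrix (Fin n) (Fin n) K)
    (h : ⨆ μ : K, Module.End.eigenspace (Matrix.toLin' A) μ = ⊤) : IsDiagonalizable A := by
  have hspan : ⊤ ≤ Submodule.span K {v : Fin n → K | ∃ μ : K, A.mulVec v = μ • v} := by
    rw [← h, iSup_le_iff]
    intro μ v hv
    refine Submodule.subset_span ⟨μ, ?_⟩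
    simpa using Module.End.mem_eigenspace_iff.1 hv
  let b₀ := Module.Basis.ofSpan hspan
  have hb₀ : ∀ i, ∃ μ : K, A.mulVec (b₀ i) = μ • b₀ i := fun i =>
    Module.Basis.ofSpan_subset hspan ⟨i, rfl⟩
  let b := b₀.reindex (b₀.indexEquiv (Pi.basisFun K (Fin n)))
  have hb : ∀ i, ∃ μ : K, A.mulVec (b i) = μ • b i := fun i => by
    simpa [b] using hb₀ _
  choose d hd using hb
  let := (Pi.basisFun K (Fin n)).invertibleToMatrix b
  refine ⟨unitOfInvertible ((Pi.basisFun K (Fin n)).toMatrix b), d, ?_⟩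
  rw [Units.eq_mul_inv_iff_mul_eq]
  ext i j
  have := congrFun (hd j) i
  rw [Matrix.mul_diagonal]
  simpa [Matrix.mul_apply, Matrix.mulVec, dotProduct, Module.Basis.toMatrix_apply, mul_comm] using this

theorem isDiagonalizable_overClosure_of_irreducible (hn : 0 < n) (A : Matrix (Fin n) (Fin n) K)
    (hirr : Irreducible (minpoly K A)) (hnK : (n : K) ≠ 0) :
    IsDiagonalizable (overClosure A) := by
  have hsq := (separable_minpoly_of_irreducible hn A hirr hnK).map
    (f := algebraMap K (AlgebraicClosure K)) |>.squarefree
  apply isDiagonalizable_of_iSup_eigenspace_eq_top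
  apply Module.End.IsSemisimple.iSup_eigenspace_eq_top
  refine Module.End.isSemisimple_of_squarefree_aeval_eq_zero hsq ?_
  have := congrArg Matrix.toLinAlgEquiv' (aeval_map_minpoly_eq_zero (L := AlgebraicClosure K) A)
  rw [map_zero, ← AlgEquiv.coe_toAlgHom, ← Polynomial.aeval_algHom_apply] at this
  exact this

end LinearAlgebra

end GenericMatrices
namespace GenericMatrices

open Polynomial

/-! ### Integral elements and coefficients of monic factors -/

section Integral

variable {Q S : Type*} [Field Q] [CommRing S] [IsDomain S] [Algebra Q S]

/-- In a domain over a field `Q` having a `Q`-point, every integral element is a constant. -/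
theorem eq_algebraMap_of_isIntegral (e : S →ₐ[Q] Q) {s : S} (hs : IsIntegral Q s) :
    s = algebraMap Q S (e s) := by
  -- The translate `s - e(s)` is killed by `e`, so its irreducible minimal polynomial has the root 0
  -- and equals `X`.
  have hw : IsIntegral Q (s - algebraMap Q S (e s)) := hs.sub isIntegral_algebraMap
  have hirr := minpoly.irreducible hw
  have h0 : aeval (e (s - algebraMap Q S (e s))) (minpoly Q (s - algebraMap Q S (e s))) = 0 := by
    rw [aeval_algHom_apply, minpoly.aeval, map_zero]
  have he : e (s - algebraMap Q S (e s)) = 0 := by simp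
  rw [he] at h0
  have hX := minpoly.eq_of_irreducible_of_monic hirr h0 (minpoly.monic hw)
  have hs0 := minpoly.aeval Q (s - algebraMap Q S (e s))
  rw [hX, minpoly.zero, aeval_X] at hs0
  exact sub_eq_zero.1 hs0

/-- The roots of `p` are among those of `c`, hence integral over `Q`, and the coefficients of `p`
are polynomials in them. -/
theorem isIntegral_coeff_of_monic_of_dvd_map {c : Q[X]} (hc : c.Monic) {p : S[X]} (hp : p.Monic)
    (hd : p ∣ c.map (algebraMap Q S)) (i : ℕ) : IsIntegral Q (p.coeff i) := by
  have hd' := map_dvd (mapRingHom (algebraMap S (FractionRing S))) hd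
  rw [coe_mapRingHom, Polynomial.map_map, ← IsScalarTower.algebraMap_eq] at hd'
  have h := integralClosure.mem_lifts_of_monic_of_dvd_map (FractionRing S) hc (hp.map _) hd'
  rw [lifts_iff_coeff_lifts] at h
  obtain ⟨y, hy⟩ := h i
  rw [coeff_map] at hy
  rw [← isIntegral_algebraMap_iff (IsFractionRing.injective S (FractionRing S)), ← hy]
  exact y.2

end Integral

/-! ### Invariance under simultaneous conjugation -/

section Invariance

variable {k : Type*} [Field k] {ι : Type*} {n : ℕ}

theorem map_mul_eq_mul_map_of_mem_genericAlgebra {S : Type*} [CommRing S]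
    {f g : EntryRing k ι n →+* S} (hfg : f.comp MvPolynomial.C = g.comp MvPolynomial.C)
    {P : Matrix (Fin n) (Fin n) S}
    (h : ∀ ν : ι, (genericMatrix k n ν).map g * P = P * (genericMatrix k n ν).map f)
    {A : Matrix (Fin n) (Fin n) (EntryRing k ι n)} (hA : A ∈ genericAlgebra k ι n) :
    A.map g * P = P * A.map f := by
  induction hA using Algebra.adjoin_induction with
  | mem x hx => obtain ⟨ν, rfl⟩ := hx; exact h ν
  | algebraMap r =>
    have hr : f (MvPolynomial.C r) = g (MvPolynomial.C r) := RingHom.congr_fun hfg r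
    have (φ : EntryRing k ι n →+* S) :
        (algebraMap k (Matrix (Fin n) (Fin n) (EntryRing k ι n)) r).map φ =
          Matrix.scalar (Fin n) (φ (MvPolynomial.C r)) := by
      ext i j
      by_cases hij : i = j <;>
        simp [Matrix.algebraMap_matrix_apply, hij, MvPolynomial.algebraMap_eq]
    rw [this, this, hr]
    exact Matrix.scalar_commute _ (fun s => Commute.all _ s) P
  | add x y _ _ hx hy =>
    rw [Matrix.map_add _ (map_add g), Matrix.map_add _ (map_add f), add_mul, mul_add, hx, hy]
  | mul x y _ _ hx hy =>
    rw [Matrix.map_mul, Matrix.map_mul, mul_assoc, hy, ← mul_assoc, hx, mul_assoc]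

/-- The coefficients of the monic factors of the characteristic polynomial of an element of the
algebra of generic matrices are invariant under simultaneous conjugation. -/
theorem coeff_invariant {Q : Type*} [Field Q] {f g : EntryRing k ι n →+* Q}
    (hfg : f.comp MvPolynomial.C = g.comp MvPolynomial.C)
    {P : Matrix (Fin n) (Fin n) Q} (hP : P.det ≠ 0)
    (h : ∀ ν : ι, (genericMatrix k n ν).map g * P = P * (genericMatrix k n ν).map f)
    {A : Matrix (Fin n) (Fin n) (EntryRing k ι n)} (hA : A ∈ genericAlgebra k ι n)
    {p : (EntryRing k ι n)[X]} (hp : p.Monic) (hd : p ∣ A.charpoly) (i : ℕ) :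
    f (p.coeff i) = g (p.coeff i) := by
  -- the segment from `1` to `P`, made invertible
  let G : Matrix (Fin n) (Fin n) Q[X] := 1 + (X : Q[X]) • (P - 1).map C
  have hG (a : Q) : G.map (evalRingHom a) = 1 + a • (P - 1) := by
    ext i j
    by_cases hij : i = j <;> simp [G, hij, mul_comm a]
  have hdet (a : Q) : evalRingHom a G.det = (1 + a • (P - 1)).det := by
    rw [RingHom.map_det, RingHom.mapMatrix_apply, hG]
  have h0 : evalRingHom 0 G.det = 1 := by rw [hdet]; simp
  have h1 : evalRingHom 1 G.det = P.det := by rw [hdet]; simp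
  have hG0 : G.det ≠ 0 := fun hz => by rw [hz, map_zero] at h0; exact zero_ne_one h0
  -- Both endpoints survive the localization: the determinant is 1 at 0 and `P.det` at 1.
  let S := Localization.Away G.det
  have : IsDomain S := IsLocalization.isDomain_localization
    (powers_le_nonZeroDivisors_of_noZeroDivisors hG0)
  let e0 : S →+* Q := IsLocalization.Away.lift G.det (g := evalRingHom (0 : Q))
    (by rw [h0]; exact isUnit_one)
  let e1 : S →+* Q := IsLocalization.Away.lift G.det (g := evalRingHom (1 : Q))
    (by rw [h1]; exact hP.isUnit)
  have he0 (q : Q[X]) : e0 (algebraMap Q[X] S q) = q.eval 0 := IsLocalization.Away.lift_eq _ _ _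
  have he1 (q : Q[X]) : e1 (algebraMap Q[X] S q) = q.eval 1 := IsLocalization.Away.lift_eq _ _ _
  have halg (q : Q) : algebraMap Q S q = algebraMap Q[X] S (C q) :=
    IsScalarTower.algebraMap_apply Q Q[X] S q
  let E0 : S →ₐ[Q] Q := { e0 with commutes' := fun q => by simp [halg, he0] }
  let H : Matrix (Fin n) (Fin n) S := G.map (algebraMap Q[X] S)
  have hH : IsUnit H.det := by
    rw [show H.det = algebraMap Q[X] S G.det from (RingHom.map_det _ _).symm]
    exact IsLocalization.Away.algebraMap_isUnit _
  have hH0 : H.map e0 = 1 := by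
    ext i j
    have := congrFun (congrFun (hG 0) i) j
    simpa [H, he0] using this
  have hH1 : H.map e1 = P := by
    ext i j
    have := congrFun (congrFun (hG 1) i) j
    simpa [H, he1] using this
  let fS : EntryRing k ι n →+* S := (algebraMap Q S).comp f
  -- The entries are independent, so the generic matrices conjugated by `H` define a ring map; it
  -- specializes to `f` at 0 and to `g` at 1.
  let F : EntryRing k ι n →+* S := MvPolynomial.eval₂Hom (fS.comp MvPolynomial.C)
    fun x => (H * (genericMatrix k n x.1).map fS * H⁻¹) x.2.1 x.2.2
  have hFC : fS.comp MvPolynomial.C = F.comp MvPolynomial.C := by ext x; simp [F]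
  have hFX (ν : ι) : (genericMatrix k n ν).map F * H = H * (genericMatrix k n ν).map fS := by
    have : (genericMatrix k n ν).map F = H * (genericMatrix k n ν).map fS * H⁻¹ := by
      ext i j
      rw [Matrix.map_apply, genericMatrix, Matrix.of_apply, MvPolynomial.coe_eval₂Hom,
        MvPolynomial.eval₂_X]
      rfl
    rw [this, mul_assoc, Matrix.nonsing_inv_mul _ hH, mul_one]
  have hfSe0 : e0.comp fS = f := by ext x <;> simp [fS, halg, he0]
  have hfSe1 : e1.comp fS = f := by ext x <;> simp [fS, halg, he1]
  have hmapX (e : S →+* Q) (ν : ι) : (genericMatrix k n ν).map (e.comp F) * H.map e =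
      H.map e * (genericMatrix k n ν).map (e.comp fS) := by
    have := congrArg (fun M => M.map e) (hFX ν)
    simpa only [Matrix.map_mul, Matrix.map_map, RingHom.coe_comp] using this
  have hext {φ ψ : EntryRing k ι n →+* Q} (hC : φ.comp MvPolynomial.C = ψ.comp MvPolynomial.C)
      (hX : ∀ ν : ι, (genericMatrix k n ν).map φ = (genericMatrix k n ν).map ψ) : φ = ψ := by
    refine MvPolynomial.ringHom_ext (fun r => RingHom.congr_fun hC r) fun x => ?_
    exact congrFun (congrFun (hX x.1) x.2.1) x.2.2
  have hF0 : e0.comp F = f := by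
    apply hext
    · rw [RingHom.comp_assoc, ← hFC, ← RingHom.comp_assoc, hfSe0]
    · intro ν
      simpa [hH0, hfSe0] using hmapX e0 ν
  have hF1 : e1.comp F = g := by
    apply hext
    · rw [RingHom.comp_assoc, ← hFC, ← RingHom.comp_assoc, hfSe1, hfg]
    · intro ν
      have h2 := hmapX e1 ν
      rw [hH1, hfSe1, ← h ν] at h2
      have hu : IsUnit P := (Matrix.isUnit_iff_isUnit_det P).2 hP.isUnit
      exact hu.mul_right_cancel h2
  have hchar : A.charpoly.map F = (A.map f).charpoly.map (algebraMap Q S) := by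
    obtain ⟨U, hU⟩ := (Matrix.isUnit_iff_isUnit_det H).2 hH
    have hconj : A.map F = (U : Matrix (Fin n) (Fin n) S) * A.map fS *
        ((U⁻¹ : (Matrix (Fin n) (Fin n) S)ˣ) : Matrix (Fin n) (Fin n) S) := by
      rw [Units.eq_mul_inv_iff_mul_eq, hU]
      exact map_mul_eq_mul_map_of_mem_genericAlgebra hFC hFX hA
    rw [← Matrix.charpoly_map, hconj, Matrix.coe_units_inv, Matrix.charpoly_units_conj, ← Matrix.charpoly_map,
      Matrix.map_map]
    rfl
  have hdvd : p.map F ∣ (A.map f).charpoly.map (algebraMap Q S) :=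
    hchar ▸ map_dvd (mapRingHom F) hd
  have hint := isIntegral_coeff_of_monic_of_dvd_map (Matrix.charpoly_monic _) (hp.map F) hdvd i
  -- Evaluation at 0 is the required `Q`-point of `S`; a constant has equal values at 0 and 1.
  have hconst := eq_algebraMap_of_isIntegral E0 hint
  rw [coeff_map] at hconst
  have hE1 := congrArg e1 hconst
  rw [halg, he1, eval_C] at hE1
  rw [← RingHom.congr_fun hF0, ← RingHom.congr_fun hF1]
  exact hE1.symm

end Invariance

end GenericMatrices
namespace GenericMatrices

open Polynomial

/-! ### Weighted entries and cyclic shifts -/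

section CyclicMatrices

variable (k : Type*) [Field k] (ι : Type*) (n : ℕ)

/-- The simultaneous cyclic shift by `a` of rows and columns of the generic matrices. -/
noncomputable def shiftHom (a : Fin n) : EntryRing k ι n →+* EntryRing k ι n :=
  (MvPolynomial.rename (R := k) fun x : ι × Fin n × Fin n => (x.1, x.2.1 + a, x.2.2 + a)).toRingHom

/-- The entry `x_jl` is multiplied by the power of a new variable `y` whose exponent is the
residue of `l - j` modulo `n`. -/
noncomputable def skewHom : EntryRing k ι n →+* (EntryRing k ι n)[X] :=
  MvPolynomial.eval₂Hom (C.comp MvPolynomial.C) fun x =>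
    C (MvPolynomial.X x) * X ^ ((x.2.2 - x.2.1 : Fin n) : ℕ)

/-- The entries `x_jl` below the diagonal are multiplied by a new variable. -/
noncomputable def wrapHom : EntryRing k ι n →+* (EntryRing k ι n)[X] :=
  MvPolynomial.eval₂Hom (C.comp MvPolynomial.C) fun x =>
    C (MvPolynomial.X x) * X ^ (if x.2.2 < x.2.1 then 1 else 0)

variable {k ι n}

@[simp]
theorem shiftHom_X (a : Fin n) (x : ι × Fin n × Fin n) :
    shiftHom k ι n a (MvPolynomial.X x) = MvPolynomial.X (x.1, x.2.1 + a, x.2.2 + a) :=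
  MvPolynomial.rename_X _ _

@[simp]
theorem shiftHom_C (a : Fin n) (r : k) :
    shiftHom k ι n a (MvPolynomial.C r) = MvPolynomial.C r :=
  MvPolynomial.rename_C _ _

@[simp]
theorem skewHom_X (x : ι × Fin n × Fin n) : skewHom k ι n (MvPolynomial.X x) =
    C (MvPolynomial.X x) * X ^ ((x.2.2 - x.2.1 : Fin n) : ℕ) := by
  simp [skewHom]

@[simp]
theorem skewHom_C (r : k) : skewHom k ι n (MvPolynomial.C r) = C (MvPolynomial.C r) := by
  simp [skewHom]

@[simp]
theorem wrapHom_X (x : ι × Fin n × Fin n) : wrapHom k ι n (MvPolynomial.X x) =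
    C (MvPolynomial.X x) * X ^ (if x.2.2 < x.2.1 then 1 else 0) := by
  rw [wrapHom, MvPolynomial.coe_eval₂Hom, MvPolynomial.eval₂_X]

@[simp]
theorem wrapHom_C (r : k) : wrapHom k ι n (MvPolynomial.C r) = C (MvPolynomial.C r) := by
  simp [wrapHom]

theorem shiftHom_injective (a : Fin n) : Function.Injective (shiftHom k ι n a) := by
  refine MvPolynomial.rename_injective _ ?_
  rintro ⟨ν, j, l⟩ ⟨ν', j', l'⟩ h
  simpa using h

theorem skewHom_injective : Function.Injective (skewHom k ι n) := by
  have h : (evalRingHom 1).comp (skewHom k ι n) = RingHom.id _ := by ext x <;> simp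
  exact Function.LeftInverse.injective (g := evalRingHom 1) fun x => RingHom.congr_fun h x

/-- The carry here makes conjugation by `diag(y ^ j)` turn the weights of `skewHom` into `n` times
those of `wrapHom`. -/
theorem val_add_val_sub (j l : Fin n) :
    (j : ℕ) + ((l - j : Fin n) : ℕ) = l + n * (if l < j then 1 else 0) := by
  by_cases h : l < j
  · rw [if_pos h, Fin.coe_sub_iff_lt.2 h]
    omega
  · rw [if_neg h, Fin.coe_sub_iff_le.2 (not_lt.1 h)]
    have := Fin.le_def.1 (not_lt.1 h)
    omega

/-- Gauss's lemma, the entry ring being integrally closed. -/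
theorem exists_monic_map_eq_of_dvd_charpoly (A : Matrix (Fin n) (Fin n) (EntryRing k ι n))
    {p : (EntryField k ι n)[X]} (hp : p.Monic) (hd : p ∣ (overField A).charpoly) :
    ∃ q : (EntryRing k ι n)[X], q.Monic ∧ q ∣ A.charpoly ∧
      q.map (algebraMap _ (EntryField k ι n)) = p := by
  rw [overField, Matrix.charpoly_map] at hd
  obtain ⟨q, hq⟩ := IsIntegrallyClosed.eq_map_mul_C_of_dvd (EntryField k ι n)
    (Matrix.charpoly_monic A) hd
  rw [hp.leadingCoeff, C_1, mul_one] at hq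
  have hqm : q.Monic := monic_of_injective
    (IsFractionRing.injective (EntryRing k ι n) (EntryField k ι n)) (hq ▸ hp)
  refine ⟨q, hqm, ?_, hq⟩
  rw [← map_dvd_map _ (IsFractionRing.injective (EntryRing k ι n) (EntryField k ι n)) hqm, hq]
  exact hd

theorem aeval_overField_map_eq_zero_iff (A : Matrix (Fin n) (Fin n) (EntryRing k ι n))
    (p : (EntryRing k ι n)[X]) :
    aeval (overField A) (p.map (algebraMap _ (EntryField k ι n))) = 0 ↔ aeval A p = 0 := by
  rw [overField, ← aeval_map_matrix]
  constructor
  · intro h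
    refine Matrix.map_injective
      (IsFractionRing.injective (EntryRing k ι n) (EntryField k ι n)) (h.trans ?_)
    exact (Matrix.map_zero _ (map_zero _)).symm
  · intro h
    rw [h]
    exact Matrix.map_zero _ (map_zero _)

/-- Invariance under `diag(1, y, ..., y ^ (n - 1))`; the point is that only powers of `y ^ n` occur.
-/
theorem skewHom_coeff_eq_expand {A : Matrix (Fin n) (Fin n) (EntryRing k ι n)}
    (hA : A ∈ genericAlgebra k ι n) {p : (EntryRing k ι n)[X]} (hp : p.Monic)
    (hd : p ∣ A.charpoly) (i : ℕ) :
    skewHom k ι n (p.coeff i) = expand _ n (wrapHom k ι n (p.coeff i)) := by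
  let Q := FractionRing (EntryRing k ι n)[X]
  let f : EntryRing k ι n →+* Q := (algebraMap _ Q).comp (skewHom k ι n)
  let g : EntryRing k ι n →+* Q :=
    (algebraMap _ Q).comp ((expand (EntryRing k ι n) n).toRingHom.comp (wrapHom k ι n))
  let y : Q := algebraMap (EntryRing k ι n)[X] Q X
  have hy : y ≠ 0 := (map_ne_zero_iff _ (IsFractionRing.injective _ Q)).2 X_ne_zero
  have h := coeff_invariant (f := f) (g := g)
    (P := Matrix.diagonal fun j : Fin n => y ^ (j : ℕ))
    (by ext x; simp [f, g])
    (by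
      rw [Matrix.det_diagonal]
      exact Finset.prod_ne_zero_iff.2 fun j _ => pow_ne_zero _ hy)
    (fun ν => by
      ext j l
      rw [Matrix.mul_diagonal, Matrix.diagonal_mul]
      have := congrArg (fun m : ℕ => y ^ m) (val_add_val_sub j l)
      simp only [pow_add, pow_mul] at this
      simp only [Matrix.map_apply, genericMatrix, Matrix.of_apply, f, g, RingHom.comp_apply,
        skewHom_X, wrapHom_X, AlgHom.toRingHom_eq_coe, RingHom.coe_coe, map_mul, map_pow, expand_C,
        expand_X]
      rw [mul_left_comm, this, mul_assoc]
      congr 1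
      exact mul_comm _ _)
    hA hp hd i
  exact IsFractionRing.injective (EntryRing k ι n)[X] Q h

/-! ### The skew polynomial ring and its lack of zero divisors -/

variable [NeZero n]

theorem ofNat_add (a b : ℕ) : Fin.ofNat n (a + b) = Fin.ofNat n a + Fin.ofNat n b := by
  ext; simp [Fin.val_add]

variable (k ι n) in
/-- Matrices `∑ diag_j (σ^j (e_m)) P^m y^m`, where `P` is the cyclic permutation matrix and `σ` the
cyclic shift: a matrix model of a skew polynomial ring. -/
noncomputable def cyclicSubring : Subring (Matrix (Fin n) (Fin n) (EntryRing k ι n)[X]) where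
  carrier := {M | (∀ j l m, (M j l).coeff m ≠ 0 → j + Fin.ofNat n m = l) ∧
    ∀ a j l, M (j + a) (l + a) = (M j l).map (shiftHom k ι n a)}
  mul_mem' := by
    rintro M N ⟨hM, hM'⟩ ⟨hN, hN'⟩
    refine ⟨fun j l m h => ?_, fun a j l => ?_⟩
    · rw [Matrix.mul_apply, finsetSum_coeff] at h
      obtain ⟨s, -, hs⟩ := Finset.exists_ne_zero_of_sum_ne_zero h
      rw [coeff_mul] at hs
      obtain ⟨⟨u, v⟩, huv, hs⟩ := Finset.exists_ne_zero_of_sum_ne_zero hs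
      rw [← hN s l v (right_ne_zero_of_mul hs), ← hM j s u (left_ne_zero_of_mul hs),
        ← Finset.HasAntidiagonal.mem_antidiagonal.1 huv, ofNat_add, add_assoc]
    · simp only [Matrix.mul_apply, Polynomial.map_sum, Polynomial.map_mul, ← hM', ← hN']
      exact (Fintype.sum_equiv (Equiv.addRight a) _ _ fun s => rfl).symm
  one_mem' := by
    refine ⟨fun j l m h => ?_, fun a j l => ?_⟩
    · by_cases hjl : j = l
      · rw [hjl, Matrix.one_apply_eq, coeff_one] at h
        have : m = 0 := by by_contra h'; exact h (if_neg h')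
        simp [hjl, this]
      · simp [Matrix.one_apply_ne hjl] at h
    · by_cases hjl : j = l
      · rw [hjl, Matrix.one_apply_eq, Matrix.one_apply_eq, Polynomial.map_one]
      · rw [Matrix.one_apply_ne hjl, Matrix.one_apply_ne (by simpa using hjl), Polynomial.map_zero]
  add_mem' := by
    rintro M N ⟨hM, hM'⟩ ⟨hN, hN'⟩
    refine ⟨fun j l m h => ?_, fun a j l => ?_⟩
    · by_cases h0 : (M j l).coeff m = 0
      · exact hN j l m (by simpa [h0] using h)
      · exact hM j l m h0
    · simp [hM', hN']
  zero_mem' := by simp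
  neg_mem' := by
    rintro M ⟨hM, hM'⟩
    exact ⟨fun j l m h => hM j l m (by simpa using h), fun a j l => by simp [hM']⟩

/-- Shift equivariance spreads one nonzero coefficient of maximal degree along its whole cyclic
diagonal. -/
theorem exists_top_coeff {M : Matrix (Fin n) (Fin n) (EntryRing k ι n)[X]}
    (hM : M ∈ cyclicSubring k ι n) (h0 : M ≠ 0) :
    ∃ d : ℕ, (∀ j, (M j (j + Fin.ofNat n d)).coeff d ≠ 0) ∧ ∀ j l, (M j l).natDegree ≤ d := by
  classical
  have hne : (Finset.univ.filter fun x : Fin n × Fin n => M x.1 x.2 ≠ 0).Nonempty := by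
    by_contra hcon
    apply h0
    refine Matrix.ext fun j l => ?_
    by_contra hjl
    exact hcon ⟨(j, l), by simpa using hjl⟩
  obtain ⟨⟨j₀, l₀⟩, hx, hmax⟩ := Finset.exists_max_image _
    (fun x : Fin n × Fin n => (M x.1 x.2).natDegree) hne
  simp only [Finset.mem_filter, Finset.mem_univ, true_and] at hx hmax
  have hlead : (M j₀ l₀).coeff (M j₀ l₀).natDegree ≠ 0 := leadingCoeff_ne_zero.2 hx
  refine ⟨(M j₀ l₀).natDegree, fun j => ?_, fun j l => ?_⟩
  · have hl := hM.1 _ _ _ hlead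
    have h2 := hM.2 (j - j₀) j₀ l₀
    have h3 : l₀ + (j - j₀) = j + Fin.ofNat n (M j₀ l₀).natDegree := by
      nth_rw 1 [← hl]
      abel
    rw [add_sub_cancel, h3] at h2
    rw [h2, coeff_map]
    exact (map_ne_zero_iff _ (shiftHom_injective _)).2 hlead
  · by_cases h : M j l = 0
    · simp [h]
    · exact hmax (j, l) h

/-- Leading coefficients multiply: in degree `d + e` a single middle index contributes to a given
entry, and both factors there are nonzero. -/
theorem eq_zero_or_eq_zero_of_mul_eq_zero {M N : Matrix (Fin n) (Fin n) (EntryRing k ι n)[X]}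
    (hM : M ∈ cyclicSubring k ι n) (hN : N ∈ cyclicSubring k ι n) (h : M * N = 0) :
    M = 0 ∨ N = 0 := by
  by_contra! hcon
  obtain ⟨d, hd, hd'⟩ := exists_top_coeff hM hcon.1
  obtain ⟨e, he, he'⟩ := exists_top_coeff hN hcon.2
  have hz := congrArg (fun B : Matrix (Fin n) (Fin n) (EntryRing k ι n)[X] =>
    (B 0 (0 + Fin.ofNat n d + Fin.ofNat n e)).coeff (d + e)) h
  simp only [Matrix.mul_apply, finsetSum_coeff, Matrix.zero_apply, coeff_zero] at hz
  rw [Finset.sum_eq_single (0 + Fin.ofNat n d)] at hz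
  · rw [coeff_mul_add_eq_of_natDegree_le (hd' _ _) (he' _ _)] at hz
    exact mul_ne_zero (hd _) (he _) hz
  · intro s _ hs
    rw [coeff_mul_add_eq_of_natDegree_le (hd' _ _) (he' _ _)]
    by_contra hne
    exact hs (hM.1 _ _ _ (left_ne_zero_of_mul hne)).symm
  · simp

/-- On the diagonal the exponents must be 0 modulo `n`, and equivariance becomes invariance under
the shifts. -/
theorem algebraMap_mem_cyclicSubring {c : (EntryRing k ι n)[X]}
    (h1 : ∀ m, c.coeff m ≠ 0 → n ∣ m) (h2 : ∀ a, c.map (shiftHom k ι n a) = c) :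
    algebraMap (EntryRing k ι n)[X] (Matrix (Fin n) (Fin n) (EntryRing k ι n)[X]) c ∈
      cyclicSubring k ι n := by
  refine ⟨fun j l m h => ?_, fun a j l => ?_⟩
  · by_cases hjl : j = l
    · simp only [Matrix.algebraMap_matrix_apply, hjl, if_true, Algebra.algebraMap_self,
        RingHom.id_apply] at h
      have : Fin.ofNat n m = 0 := by
        ext
        simpa using Nat.mod_eq_zero_of_dvd (h1 m h)
      rw [hjl, this, add_zero]
    · simp [Matrix.algebraMap_matrix_apply, hjl] at h
  · by_cases hjl : j = l <;> simp [Matrix.algebraMap_matrix_apply, hjl, h2]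

theorem map_skewHom_mem_cyclicSubring {A : Matrix (Fin n) (Fin n) (EntryRing k ι n)}
    (hA : A ∈ genericAlgebra k ι n) : A.map (skewHom k ι n) ∈ cyclicSubring k ι n := by
  induction hA using Algebra.adjoin_induction with
  | mem x hx =>
    obtain ⟨ν, rfl⟩ := hx
    refine ⟨fun j l m h => ?_, fun a j l => ?_⟩
    · simp only [genericMatrix, Matrix.map_apply, Matrix.of_apply, skewHom_X,
        coeff_C_mul_X_pow] at h
      have hm : m = ((l - j : Fin n) : ℕ) := by
        by_contra h'
        exact h (if_neg h')
      rw [hm, Fin.ofNat_val_eq_self, add_sub_cancel]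
    · simp [genericMatrix]
  | algebraMap r =>
    have : (algebraMap k (Matrix (Fin n) (Fin n) (EntryRing k ι n)) r).map (skewHom k ι n) =
        algebraMap (EntryRing k ι n)[X] _ (C (MvPolynomial.C r)) := by
      refine Matrix.ext fun i j => ?_
      by_cases hij : i = j <;>
        simp [Matrix.algebraMap_matrix_apply, hij, MvPolynomial.algebraMap_eq]
    rw [this]
    refine algebraMap_mem_cyclicSubring (fun m hm => ?_) fun a => by simp
    have : m = 0 := by
      by_contra h'
      exact hm (coeff_C_of_ne_zero h')
    simp [this]
  | add x y _ _ hx hy =>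
    rw [Matrix.map_add _ (map_add _)]
    exact add_mem hx hy
  | mul x y _ _ hx hy =>
    rw [Matrix.map_mul]
    exact mul_mem hx hy

/-- Invariance under a cyclic permutation matrix; a shift preserves `l - j`, hence the weights. -/
theorem map_shiftHom_skewHom_coeff {A : Matrix (Fin n) (Fin n) (EntryRing k ι n)}
    (hA : A ∈ genericAlgebra k ι n) {p : (EntryRing k ι n)[X]} (hp : p.Monic)
    (hd : p ∣ A.charpoly) (i : ℕ) (a : Fin n) :
    (skewHom k ι n (p.coeff i)).map (shiftHom k ι n a) = skewHom k ι n (p.coeff i) := by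
  let Q := FractionRing (EntryRing k ι n)[X]
  let f : EntryRing k ι n →+* Q := (algebraMap _ Q).comp (skewHom k ι n)
  let g : EntryRing k ι n →+* Q :=
    (algebraMap _ Q).comp ((mapRingHom (shiftHom k ι n a)).comp (skewHom k ι n))
  have h := coeff_invariant (f := f) (g := g) (P := (Equiv.addRight a).toPEquiv.toMatrix)
    (by ext x; simp [f, g])
    (by
      have := Matrix.det_permutation (R := Q) (Equiv.addRight a)
      rw [Equiv.Perm.permMatrix] at this
      rw [this]
      rcases Int.units_eq_one_or (Equiv.Perm.sign (Equiv.addRight a)) with h | h <;> simp [h])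
    (fun ν => by
      rw [PEquiv.mul_toMatrix_toPEquiv, PEquiv.toMatrix_toPEquiv_mul]
      ext j l
      simp [genericMatrix, f, g, show l + -a - j = l - (j + a) by abel])
    hA hp hd i
  exact (IsFractionRing.injective (EntryRing k ι n)[X] Q h).symm

theorem aeval_map_skewHom_mem_cyclicSubring {A : Matrix (Fin n) (Fin n) (EntryRing k ι n)}
    (hA : A ∈ genericAlgebra k ι n) {p : (EntryRing k ι n)[X]} (hp : p.Monic)
    (hd : p ∣ A.charpoly) : (aeval A p).map (skewHom k ι n) ∈ cyclicSubring k ι n := by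
  rw [aeval_map_matrix, aeval_def, eval₂_eq_sum_range]
  refine sum_mem fun i _ => mul_mem ?_ (pow_mem (map_skewHom_mem_cyclicSubring hA) i)
  rw [coeff_map]
  refine algebraMap_mem_cyclicSubring (fun m hm => ?_) (map_shiftHom_skewHom_coeff hA hp hd i)
  rw [skewHom_coeff_eq_expand hA hp hd, coeff_expand (NeZero.pos n)] at hm
  by_contra h
  exact hm (if_neg h)

/-! ### Irreducibility of the minimal polynomial -/

theorem aeval_eq_zero_or_of_mul_eq_zero {A : Matrix (Fin n) (Fin n) (EntryRing k ι n)}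
    (hA : A ∈ genericAlgebra k ι n) {p q : (EntryRing k ι n)[X]} (hp : p.Monic) (hq : q.Monic)
    (hpd : p ∣ A.charpoly) (hqd : q ∣ A.charpoly) (h : aeval A (p * q) = 0) :
    aeval A p = 0 ∨ aeval A q = 0 := by
  have hinj := Matrix.map_injective (m := Fin n) (n := Fin n)
    (skewHom_injective (k := k) (ι := ι) (n := n))
  have hz : (0 : Matrix (Fin n) (Fin n) (EntryRing k ι n)).map (skewHom k ι n) = 0 :=
    Matrix.map_zero _ (map_zero _)
  have := congrArg (fun M => M.map (skewHom k ι n)) h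
  simp only [map_mul, Matrix.map_mul, hz] at this
  rcases eq_zero_or_eq_zero_of_mul_eq_zero (aeval_map_skewHom_mem_cyclicSubring hA hp hpd)
    (aeval_map_skewHom_mem_cyclicSubring hA hq hqd) this with h | h
  · exact Or.inl (hinj (h.trans hz.symm))
  · exact Or.inr (hinj (h.trans hz.symm))

theorem irreducible_minpoly {A : Matrix (Fin n) (Fin n) (EntryRing k ι n)}
    (hA : A ∈ genericAlgebra k ι n) :
    Irreducible (minpoly (EntryField k ι n) (overField A)) := by
  have hint : IsIntegral (EntryField k ι n) (overField A) := Matrix.isIntegral _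
  -- By minimality, a factor that annihilates the matrix has full degree, so its cofactor is 1.
  have hmin : ∀ f g : (EntryField k ι n)[X], f.Monic → g.Monic →
      f * g = minpoly (EntryField k ι n) (overField A) → aeval (overField A) f = 0 → g = 1 := by
    intro f g hf hg hfg h0
    have hle := natDegree_le_natDegree (minpoly.min _ _ hf h0)
    rw [← hfg, hf.natDegree_mul hg] at hle
    exact hg.natDegree_eq_zero.1 (by omega)
  rw [irreducible_of_monic (minpoly.monic hint) (minpoly.ne_one _ _)]
  intro f g hf hg hfg
  have hdvd : f * g ∣ (overField A).charpoly := hfg ▸ Matrix.minpoly_dvd_charpoly _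
  obtain ⟨p, hpm, hpd, rfl⟩ :=
    exists_monic_map_eq_of_dvd_charpoly A hf ((dvd_mul_right f g).trans hdvd)
  obtain ⟨q, hqm, hqd, rfl⟩ :=
    exists_monic_map_eq_of_dvd_charpoly A hg ((dvd_mul_left g _).trans hdvd)
  have h0 : aeval A (p * q) = 0 := by
    rw [← aeval_overField_map_eq_zero_iff, Polynomial.map_mul, hfg, minpoly.aeval]
  rcases aeval_eq_zero_or_of_mul_eq_zero hA hpm hqm hpd hqd h0 with h | h
  · exact Or.inr (hmin _ _ hf hg hfg ((aeval_overField_map_eq_zero_iff A p).2 h))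
  · exact Or.inl (hmin _ _ hg hf (by rw [mul_comm, hfg]) ((aeval_overField_map_eq_zero_iff A q).2 h))

end CyclicMatrices

end GenericMatrices
theorem mainTheorem6 (k : Type*) [Field k] (ι : Type*) (n : ℕ) (hn : 0 < n)
    (A : Matrix (Fin n) (Fin n) (GenericMatrices.EntryRing k ι n))
    (hA : A ∈ GenericMatrices.genericAlgebra k ι n) :
    -- the minimal polynomial is irreducible, and `A` is diagonalizable if `char k` does not divide `n`
    (Irreducible (minpoly (GenericMatrices.EntryField k ι n) (GenericMatrices.overField A)) ∧
      ((n : k) ≠ 0 →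
        GenericMatrices.IsDiagonalizable
          (GenericMatrices.overClosure (GenericMatrices.overField A)))) ∧
    -- the eigenvalues are the roots of the minimal polynomial, all with the same multiplicity
    ((∀ a : AlgebraicClosure (GenericMatrices.EntryField k ι n),
        GenericMatrices.IsEigenvalue
            (GenericMatrices.overClosure (GenericMatrices.overField A)) a ↔
          Polynomial.aeval a
            (minpoly (GenericMatrices.EntryField k ι n) (GenericMatrices.overField A)) = 0) ∧
      (∃ r : ℕ, 0 < r ∧ ∀ a : AlgebraicClosure (GenericMatrices.EntryField k ι n),
        GenericMatrices.IsEigenvalue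
            (GenericMatrices.overClosure (GenericMatrices.overField A)) a →
          Polynomial.rootMultiplicity a
            (GenericMatrices.overClosure (GenericMatrices.overField A)).charpoly = r)) ∧
    -- the characteristic polynomial is a power of the minimal polynomial
    (∃ r : ℕ, 0 < r ∧
      (GenericMatrices.overField A).charpoly =
        minpoly (GenericMatrices.EntryField k ι n) (GenericMatrices.overField A) ^ r) := by

  have : NeZero n := ⟨hn.ne'⟩
  have hirr := GenericMatrices.irreducible_minpoly hA
  have hK (h : (n : k) ≠ 0) : (n : GenericMatrices.EntryField k ι n) ≠ 0 := by
    rw [← map_natCast (algebraMap k (GenericMatrices.EntryField k ι n))]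
    exact (map_ne_zero _).2 h
  exact ⟨⟨hirr, fun h =>
      GenericMatrices.isDiagonalizable_overClosure_of_irreducible hn _ hirr (hK h)⟩,
    ⟨GenericMatrices.isEigenvalue_overClosure_iff hn _ hirr,
      GenericMatrices.exists_rootMultiplicity_eq hn _ hirr⟩,
    GenericMatrices.charpoly_eq_minpoly_pow_of_irreducible hn _ hirr⟩
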